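/- Let $(X,d)$ be a compact geodesic metric space (any two points $x,y$ are joined by an isometrically embedded interval $[0,d(x,y)]$) with a basepoint $\bullet\in X$. For $r>0$ let $\operatorname{Rips}(X,r)$ be the open Rips complex: the simplicial complex with vertex set $X$ whose simplices are the nonempty finite subsets of diameter less than $r$. For $0<p<q$ let $i_{p,q}\colon \pi_1(\operatorname{Rips}(X,p),\bullet)\to\pi_1(\operatorname{Rips}(X,q),\bullet)$ be the homomorphism induced by the inclusion. Call $p>0$ a *left critical value* if for all small enough $\varepsilon>0$ the map $i_{p-\varepsilon,p}$ is not an isomorphism, a *right critical value* if for all $\varepsilon>0$ the map $i_{p,p+\varepsilon}$ is not an isomorphism, and a *critical value* if it is either of these. Then every critical value is a right critical value. Moreover, there are no left critical values; in other words, no bonding map fails to be an isomorphism from the left: for every $p>0$ there is $\varepsilon_0>0$ such that $i_{q,p}$ is an isomorphism for all $q>0$ with $p-\varepsilon_0<q<p$. -/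

import Mathlib

open CategoryTheory

universe u v w

/-! ### Geodesic spaces -/

/-- A metric space is geodesic if any two points `x`, `y` are joined by an isometric copy of the
interval `[0, dist x y]`. -/
def IsGeodesicSpace (X : Type u) [MetricSpace X] : Prop :=
  ∀ x y : X, ∃ γ : ℝ → X, γ 0 = x ∧ γ (dist x y) = y ∧
    ∀ s ∈ Set.Icc 0 (dist x y), ∀ t ∈ Set.Icc 0 (dist x y), dist (γ s) (γ t) = |s - t|

/-! ### Geometric realization of an abstract simplicial complex -/

/-- A point of the geometric realization: a finitely supported family of barycentric coordinates,
nonnegative, with sum `1`, whose support is a simplex of `K`. -/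
@[ext]
structure GeomRealization {V : Type u} (K : AbstractSimplicialComplex V) where
  weight : V →₀ ℝ
  nonneg : ∀ v, 0 ≤ weight v
  sum_eq_one : (weight.sum fun _ a => a) = 1
  support_mem : weight.support ∈ K.faces

namespace GeomRealization

variable {V : Type u}

/-- The closed simplex `|σ|` inside the realization. -/
def closedSimplex (K : AbstractSimplicialComplex V) (σ : Finset V) :
    Set (GeomRealization K) :=
  {p | p.weight.support ⊆ σ}

/-- The Euclidean topology of a closed simplex, given by the barycentric coordinates. -/
abbrev simplexTopology (K : AbstractSimplicialComplex V) (σ : Finset V) :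
    TopologicalSpace (closedSimplex K σ) :=
  TopologicalSpace.induced (fun p => (p.1.weight : V → ℝ)) Pi.topologicalSpace

/-- The weak (coherent) topology: a set is open iff its intersection with every closed simplex of
`K` is open in the Euclidean topology of that simplex. -/
instance (K : AbstractSimplicialComplex V) : TopologicalSpace (GeomRealization K) :=
  ⨆ σ : K.faces, TopologicalSpace.coinduced
    (Subtype.val : closedSimplex K σ.1 → GeomRealization K) (simplexTopology K σ.1)

/-- The vertex `v`, as a point of the realization. -/
noncomputable def vertex (K : AbstractSimplicialComplex V) (v : V) : GeomRealization K where
  weight := Finsupp.single v 1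
  nonneg x := by
    classical
    rw [Finsupp.single_apply]
    split_ifs <;> norm_num
  sum_eq_one := by simp
  support_mem := by
    rw [Finsupp.support_single v one_ne_zero]
    exact K.singleton_mem v

/-- The map of realizations given by the inclusion of a subcomplex; it is the identity on
vertices. -/
def inclusionFun {K L : AbstractSimplicialComplex V} (h : K.faces ⊆ L.faces)
    (p : GeomRealization K) : GeomRealization L where
  weight := p.weight
  nonneg := p.nonneg
  sum_eq_one := p.sum_eq_one
  support_mem := h p.support_mem

theorem continuous_inclusionFun {K L : AbstractSimplicialComplex V} (h : K.faces ⊆ L.faces) :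
    Continuous (inclusionFun h) := by
  refine continuous_iSup_dom.2 fun σ => ?_
  refine continuous_coinduced_dom.2 ?_
  let _ := simplexTopology K σ.1
  let _ := simplexTopology L σ.1
  have h1 : Continuous (Subtype.val : closedSimplex L σ.1 → GeomRealization L) :=
    continuous_iff_coinduced_le.2 (le_iSup (fun τ : L.faces => TopologicalSpace.coinduced
      (Subtype.val : closedSimplex L τ.1 → GeomRealization L) (simplexTopology L τ.1))
      ⟨σ.1, h σ.2⟩)
  have h2 : Continuous (fun p : closedSimplex K σ.1 =>
      (⟨inclusionFun h p.1, p.2⟩ : closedSimplex L σ.1)) :=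
    continuous_induced_rng.2 continuous_induced_dom
  exact h1.comp h2

/-- `inclusionFun` as a bundled continuous map. -/
def inclusion {K L : AbstractSimplicialComplex V} (h : K.faces ⊆ L.faces) :
    C(GeomRealization K, GeomRealization L) :=
  ⟨inclusionFun h, continuous_inclusionFun h⟩

end GeomRealization

/-! ### The open Rips filtration and its fundamental groups -/

/-- The open Rips complex of `X` at scale `r > 0`: its simplices are the nonempty finite subsets
of `X` of diameter less than `r`. -/
def openRips (X : Type u) [MetricSpace X] (r : Set.Ioi (0 : ℝ)) : AbstractSimplicialComplex X where
  faces := {σ | σ.Nonempty ∧ Metric.diam (σ : Set X) < r}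
  isRelLowerSet_faces := by
    intro σ hσ
    refine ⟨hσ.1, fun τ hτσ hτ => ⟨hτ, ?_⟩⟩
    exact (Metric.diam_mono (Finset.coe_subset.2 hτσ) σ.finite_toSet.isBounded).trans_lt hσ.2
  singleton_mem x := by
    refine ⟨Finset.singleton_nonempty x, ?_⟩
    rw [Finset.coe_singleton, Metric.diam_singleton]
    exact r.2

theorem openRips_mono (X : Type u) [MetricSpace X] {p q : Set.Ioi (0 : ℝ)} (h : p ≤ q) :
    (openRips X p).faces ⊆ (openRips X q).faces :=
  fun _ hσ => ⟨hσ.1, hσ.2.trans_le h⟩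

/-- The `π₁`-persistence of `(X, x₀)` via the open Rips filtration: the groups
`π₁(Rips(X, r), x₀)`, `r > 0`, with the homomorphisms induced by the inclusions. -/
noncomputable def openRipsPiOne (X : Type u) [MetricSpace X] (x₀ : X) :
    Set.Ioi (0 : ℝ) ⥤ GrpCat.{u} where
  obj r := GrpCat.of
    (FundamentalGroup (GeomRealization (openRips X r)) (GeomRealization.vertex (openRips X r) x₀))
  map {p q} f := GrpCat.ofHom
    (FundamentalGroup.map (GeomRealization.inclusion (openRips_mono X (leOfHom f)))
      (GeomRealization.vertex (openRips X p) x₀))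
  map_id r := by
    ext γ
    induction γ using Path.Homotopic.Quotient.ind with
    | mk γ => rfl
  map_comp f g := by
    ext γ
    induction γ using Path.Homotopic.Quotient.ind with
    | mk γ => rfl

/-! ### Critical values of a filtration -/

/-- `p` is a left critical value of the filtration `C`: for all small enough `ε > 0` the bonding
map from `p - ε` to `p` is not an isomorphism. -/
def IsLeftCriticalValue {𝒞 : Type v} [Category.{w} 𝒞] (C : Set.Ioi (0 : ℝ) ⥤ 𝒞)
    (p : Set.Ioi (0 : ℝ)) : Prop :=
  ∃ ε₀ : ℝ, 0 < ε₀ ∧ ∀ (q : Set.Ioi (0 : ℝ)) (h : q < p), (p : ℝ) - ε₀ < q →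
    ¬ IsIso (C.map (homOfLE h.le))

/-- `p` is a right critical value of the filtration `C`: for all `ε > 0` the bonding map from `p`
to `p + ε` is not an isomorphism. -/
def IsRightCriticalValue {𝒞 : Type v} [Category.{w} 𝒞] (C : Set.Ioi (0 : ℝ) ⥤ 𝒞)
    (p : Set.Ioi (0 : ℝ)) : Prop :=
  ∀ (q : Set.Ioi (0 : ℝ)) (h : p < q), ¬ IsIso (C.map (homOfLE h.le))

/-- A critical value is a left critical value or a right critical value. -/
def IsCriticalValue {𝒞 : Type v} [Category.{w} 𝒞] (C : Set.Ioi (0 : ℝ) ⥤ 𝒞)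
    (p : Set.Ioi (0 : ℝ)) : Prop :=
  IsLeftCriticalValue C p ∨ IsRightCriticalValue C p

/-!
A group-valued 1-cocycle on a simplicial complex is the transition data of a covering of its
realization, and the monodromy of this covering along an edge is multiplication by the value of the
cocycle. As edge paths represent all path classes between vertices, a subcomplex whose cocycles all
extend to the ambient complex is `π₁`-injective: apply this to the tautological cocycle with values
in its own fundamental group.

A cocycle `g` on the Rips complex at scale `q` extends to scale `p` by the formula
`φ x y = g b y * g x b`, where `b` is a point about two thirds of the way from `x` to `y`. The
cocycle identity of `φ` on a triple of diameter less than `p` follows by comparison with a nearby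
triple of diameter less than `q`. Total boundedness supplies such triples for all `q` close enough
to `p`: up to a small error there are only finitely many triples, each of diameter strictly less
than `p`. Surjectivity holds for all scales, since long edges can be subdivided.
-/

/-! ### Path classes inside simply connected subsets -/

section PathClass

variable {Y : Type u} [TopologicalSpace Y] {S T : Set Y} {a b c : Y}

/-- The homotopy class of a path, as a morphism of the fundamental groupoid. -/
abbrev pathClass (γ : Path a b) : FundamentalGroupoid.mk a ⟶ FundamentalGroupoid.mk b :=
  FundamentalGroupoid.fromPath (Path.Homotopic.Quotient.mk γ)

theorem exists_pathClass_eq (f : FundamentalGroupoid.mk a ⟶ FundamentalGroupoid.mk b) :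
    ∃ γ : Path a b, pathClass γ = f :=
  Path.Homotopic.Quotient.mk_surjective f

theorem pathClass_trans (γ : Path a b) (γ' : Path b c) :
    pathClass (γ.trans γ') = pathClass γ ≫ pathClass γ' :=
  rfl

theorem pathClass_subpath_comp (γ : Path a b) (r s t : unitInterval) :
    pathClass (γ.subpath r s) ≫ pathClass (γ.subpath s t) = pathClass (γ.subpath r t) :=
  Path.Homotopic.Quotient.eq.2 ⟨Path.Homotopy.subpathTransSubpath γ r s t⟩

theorem fundamentalGroupoid_hom_induction {ι : Type w} {U : ι → Set Y} (hU : ∀ i, IsOpen (U i))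
    (hcover : ∀ y, ∃ i, y ∈ U i)
    {P : ∀ {a b : Y}, (FundamentalGroupoid.mk a ⟶ FundamentalGroupoid.mk b) → Prop}
    (of_path : ∀ (i : ι) {a b : Y} (γ : Path a b), (∀ t, γ t ∈ U i) → P (pathClass γ))
    (of_comp : ∀ {a b c : Y} {f : FundamentalGroupoid.mk a ⟶ FundamentalGroupoid.mk b}
      {g : FundamentalGroupoid.mk b ⟶ FundamentalGroupoid.mk c}, P f → P g → P (f ≫ g))
    (f : FundamentalGroupoid.mk a ⟶ FundamentalGroupoid.mk b) : P f := by
  obtain ⟨γ, rfl⟩ := exists_pathClass_eq f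
  obtain ⟨γ, rfl, rfl⟩ := γ
  obtain ⟨t, ht0, htm, ⟨n, hn⟩, ht⟩ := exists_monotone_Icc_subset_open_cover_unitInterval
    (c := fun i => γ ⁻¹' U i) (fun i => (hU i).preimage γ.continuous)
    (fun s _ => Set.mem_iUnion.2 (hcover (γ s)))
  let γ' : Path (γ 0) (γ 1) := ⟨γ, rfl, rfl⟩
  have initial_segment (k : ℕ) : P (pathClass (γ'.subpath (t 0) (t k))) := by
    induction k with
    | zero =>
      obtain ⟨i, hi⟩ := hcover (γ (t 0))
      rw [Path.subpath_self]
      exact of_path i _ fun _ => hi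
    | succ k ih =>
      obtain ⟨i, hi⟩ := ht k
      rw [← pathClass_subpath_comp γ' (t 0) (t k)]
      refine of_comp ih (of_path i _ fun s => ?_)
      obtain ⟨r, hr, hrs⟩ := Path.range_subpath_of_le γ' _ _ (htm k.le_succ) ▸
        Set.mem_range_self (f := γ'.subpath (t k) (t (k + 1))) s
      exact hrs ▸ hi hr
  have whole_path {s s' : unitInterval} (hs : s = 0) (hs' : s' = 1)
      (h : P (pathClass (γ'.subpath s s'))) : P (pathClass γ') := by
    subst hs hs'
    rwa [Path.subpath_zero_one] at h
  exact whole_path ht0 (hn n le_rfl) (initial_segment n)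

/-- The common homotopy class of all paths from `a` to `b` inside a simply connected set. -/
noncomputable def pathClassIn (hS : IsSimplyConnected S) (ha : a ∈ S) (hb : b ∈ S) :
    FundamentalGroupoid.mk a ⟶ FundamentalGroupoid.mk b :=
  have := hS.simplyConnectedSpace
  pathClass
    ((PathConnectedSpace.somePath (⟨a, ha⟩ : S) ⟨b, hb⟩).map continuous_subtype_val)

theorem pathClass_eq_pathClassIn (hS : IsSimplyConnected S) (ha : a ∈ S) (hb : b ∈ S)
    (γ : Path a b) (h : ∀ t, γ t ∈ S) : pathClass γ = pathClassIn hS ha hb := by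
  have := hS.simplyConnectedSpace
  let γ' : Path (⟨a, ha⟩ : S) ⟨b, hb⟩ :=
    { toFun := fun t => ⟨γ t, h t⟩
      continuous_toFun := by fun_prop
      source' := Subtype.ext γ.source
      target' := Subtype.ext γ.target }
  exact Quotient.sound ((SimplyConnectedSpace.paths_homotopic γ'
    (PathConnectedSpace.somePath (⟨a, ha⟩ : S) ⟨b, hb⟩)).map ⟨Subtype.val, continuous_subtype_val⟩)

theorem exists_pathClass_eq_pathClassIn (hS : IsSimplyConnected S) (ha : a ∈ S) (hb : b ∈ S) :
    ∃ γ : Path a b, (∀ t, γ t ∈ S) ∧ pathClass γ = pathClassIn hS ha hb :=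
  have := hS.simplyConnectedSpace
  ⟨(PathConnectedSpace.somePath (⟨a, ha⟩ : S) ⟨b, hb⟩).map continuous_subtype_val,
    fun t => (PathConnectedSpace.somePath (⟨a, ha⟩ : S) ⟨b, hb⟩ t).2, rfl⟩

theorem pathClassIn_mono (hS : IsSimplyConnected S) (hT : IsSimplyConnected T) (h : S ⊆ T)
    (ha : a ∈ S) (hb : b ∈ S) : pathClassIn hS ha hb = pathClassIn hT (h ha) (h hb) := by
  obtain ⟨γ, hγ, hγS⟩ := exists_pathClass_eq_pathClassIn hS ha hb
  rw [← hγS, pathClass_eq_pathClassIn hT (h ha) (h hb) γ fun t => h (hγ t)]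

theorem pathClassIn_self (hS : IsSimplyConnected S) (ha : a ∈ S) :
    pathClassIn hS ha ha = 𝟙 (FundamentalGroupoid.mk a) :=
  (pathClass_eq_pathClassIn hS ha ha (Path.refl a) fun _ => ha).symm

theorem pathClassIn_comp (hS : IsSimplyConnected S) (ha : a ∈ S) (hb : b ∈ S) (hc : c ∈ S) :
    pathClassIn hS ha hb ≫ pathClassIn hS hb hc = pathClassIn hS ha hc := by
  obtain ⟨γ, hγ, hγS⟩ := exists_pathClass_eq_pathClassIn hS ha hb
  obtain ⟨γ', hγ', hγS'⟩ := exists_pathClass_eq_pathClassIn hS hb hc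
  rw [← hγS, ← hγS', ← pathClass_trans]
  refine pathClass_eq_pathClassIn hS ha hc _ fun t => ?_
  have ht : γ.trans γ' t ∈ Set.range γ ∪ Set.range γ' := Path.trans_range γ γ' ▸ ⟨t, rfl⟩
  rcases ht with ⟨s, hs⟩ | ⟨s, hs⟩
  · exact hs ▸ hγ s
  · exact hs ▸ hγ' s

theorem map_pathClassIn {Z : Type v} [TopologicalSpace Z] {T : Set Z} (hS : IsSimplyConnected S)
    (hT : IsSimplyConnected T) (f : C(Y, Z)) (h : Set.MapsTo f S T) (ha : a ∈ S) (hb : b ∈ S) :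
    (FundamentalGroupoid.map f).map (pathClassIn hS ha hb) =
      pathClassIn hT (h ha) (h hb) := by
  obtain ⟨γ, hγ, hγS⟩ := exists_pathClass_eq_pathClassIn hS ha hb
  rw [← hγS]
  exact pathClass_eq_pathClassIn hT (h ha) (h hb) (γ.map f.continuous) fun t => h (hγ t)

theorem monodromy_pathClassIn {E : Type v} [TopologicalSpace E] {π : E → Y}
    (hπ : IsCoveringMap π) (hS : IsSimplyConnected S) {s : S → E} (hs : Continuous s)
    (hπs : ∀ y, π (s y) = y) (ha : a ∈ S) (hb : b ∈ S) :
    hπ.monodromy (pathClassIn hS ha hb) ⟨s ⟨a, ha⟩, hπs _⟩ = ⟨s ⟨b, hb⟩, hπs _⟩ := by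
  obtain ⟨γ, hγ, hγS⟩ := exists_pathClass_eq_pathClassIn hS ha hb
  let lift : Path (s ⟨a, ha⟩) (s ⟨b, hb⟩) :=
    { toFun := fun t => s ⟨γ t, hγ t⟩
      continuous_toFun := hs.comp (by fun_prop)
      source' := congrArg s (Subtype.ext γ.source)
      target' := congrArg s (Subtype.ext γ.target) }
  rw [← hγS]
  exact hπ.monodromy_eq_of_map_eq (Path.Homotopic.Quotient.mk lift)
    (congrArg Path.Homotopic.Quotient.mk (Path.ext (funext fun t => hπs ⟨γ t, hγ t⟩)))

end PathClass

/-! ### Simplices and open stars in the realization -/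

namespace GeomRealization

variable {V : Type u} {K : AbstractSimplicialComplex V} {σ : Finset V} {v w : V}

/-- The standard simplex with vertex set `σ`, as a set of functions on `V`. -/
def coordSimplex (σ : Finset V) : Set (V → ℝ) :=
  {f | (∀ v, 0 ≤ f v) ∧ (∀ v ∉ σ, f v = 0) ∧ ∑ v ∈ σ, f v = 1}

theorem convex_coordSimplex (σ : Finset V) : Convex ℝ (coordSimplex σ) := by
  rintro f ⟨hf0, hfσ, hf1⟩ g ⟨hg0, hgσ, hg1⟩ a b ha hb hab
  refine ⟨fun v => ?_, fun v hv => ?_, ?_⟩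
  · exact add_nonneg (mul_nonneg ha (hf0 v)) (mul_nonneg hb (hg0 v))
  · simp [hfσ v hv, hgσ v hv]
  · simp [Finset.sum_add_distrib, ← Finset.mul_sum, hf1, hg1, hab]

theorem mem_closedSimplex_support (p : GeomRealization K) :
    p ∈ closedSimplex K p.weight.support :=
  Finset.Subset.refl _

theorem weight_mem_coordSimplex (p : GeomRealization K) (hp : p ∈ closedSimplex K σ) :
    (p.weight : V → ℝ) ∈ coordSimplex σ := by
  refine ⟨p.nonneg, fun v hv => Finsupp.notMem_support_iff.1 fun h => hv (hp h), ?_⟩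
  rw [← p.sum_eq_one]
  exact (Finset.sum_subset hp fun v _ hv => Finsupp.notMem_support_iff.1 hv).symm

/-- The point of the realization with given barycentric coordinates in a face. -/
noncomputable def ofCoords (hσ : σ ∈ K.faces) (f : coordSimplex σ) : GeomRealization K where
  weight := Finsupp.onFinset σ f.1 fun v hv => not_imp_comm.1 (f.2.2.1 v) hv
  nonneg := f.2.1
  sum_eq_one := (Finsupp.onFinset_sum _ fun _ => rfl).trans f.2.2.2
  support_mem := by
    refine K.isRelLowerSet_faces.mem_of_le hσ Finsupp.support_onFinset_subset ?_
    obtain ⟨v, -, hv⟩ := Finset.exists_ne_zero_of_sum_ne_zero (f.2.2.2.trans_ne one_ne_zero)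
    exact ⟨v, Finsupp.mem_support_iff.2 hv⟩

theorem ofCoords_mem_closedSimplex (hσ : σ ∈ K.faces) (f : coordSimplex σ) :
    ofCoords hσ f ∈ closedSimplex K σ :=
  fun v hv => not_imp_comm.1 (f.2.2.1 v) (Finsupp.mem_support_iff.1 hv)

theorem ofCoords_weight (hσ : σ ∈ K.faces) (p : GeomRealization K) (hp : p ∈ closedSimplex K σ) :
    ofCoords hσ ⟨p.weight, weight_mem_coordSimplex p hp⟩ = p := by
  ext v
  rfl

theorem isOpen_iff {U : Set (GeomRealization K)} :
    IsOpen U ↔ ∀ σ (hσ : σ ∈ K.faces), IsOpen (ofCoords hσ ⁻¹' U) := by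
  have isOpen_iff_simplexTopology : IsOpen U ↔ ∀ σ : K.faces, @IsOpen _ (simplexTopology K σ.1)
      ((Subtype.val : closedSimplex K σ.1 → GeomRealization K) ⁻¹' U) :=
    isOpen_iSup_iff.trans (forall_congr' fun _ => isOpen_coinduced)
  rw [isOpen_iff_simplexTopology, SetCoe.forall]
  refine forall₂_congr fun σ hσ => ?_
  constructor <;> intro h <;> obtain ⟨O, hO, hOU⟩ := isOpen_induced_iff.1 h <;>
    refine isOpen_induced_iff.2 ⟨O, hO, ?_⟩
  · ext f
    exact Set.ext_iff.1 hOU ⟨ofCoords hσ f, ofCoords_mem_closedSimplex hσ f⟩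
  · ext p
    have hp := Set.ext_iff.1 hOU ⟨p.1.weight, weight_mem_coordSimplex p.1 p.2⟩
    rwa [Set.mem_preimage, Set.mem_preimage, ofCoords_weight hσ p.1 p.2] at hp

theorem continuous_ofCoords (hσ : σ ∈ K.faces) : Continuous (ofCoords hσ) :=
  continuous_def.2 fun _ hU => isOpen_iff.1 hU σ hσ

theorem continuous_of_continuous_weight {A : Type w} [TopologicalSpace A] (hσ : σ ∈ K.faces)
    {f : A → GeomRealization K} (hfσ : ∀ a, f a ∈ closedSimplex K σ)
    (hf : ∀ v, Continuous fun a => (f a).weight v) : Continuous f := by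
  have hcoords : Continuous fun a =>
      (⟨(f a).weight, weight_mem_coordSimplex (f a) (hfσ a)⟩ : coordSimplex σ) :=
    (continuous_pi hf).subtype_mk _
  exact ((continuous_ofCoords hσ).comp hcoords).congr fun a => ofCoords_weight hσ (f a) (hfσ a)

theorem continuous_of_continuous_comp_ofCoords {Y : Type v} [TopologicalSpace Y]
    {U : Set (GeomRealization K)} (hU : IsOpen U) {f : U → Y}
    (hf : ∀ σ (hσ : σ ∈ K.faces),
      Continuous fun x : {x : coordSimplex σ // ofCoords hσ x ∈ U} => f ⟨ofCoords hσ x, x.2⟩) :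
    Continuous f := by
  refine continuous_def.2 fun O hO => ?_
  rw [hU.isOpenEmbedding_subtypeVal.isOpen_iff_image_isOpen, isOpen_iff]
  intro σ hσ
  have hUσ : IsOpen {x : coordSimplex σ | ofCoords hσ x ∈ U} := isOpen_iff.1 hU σ hσ
  convert hUσ.isOpenEmbedding_subtypeVal.isOpen_iff_image_isOpen.1 (hO.preimage (hf σ hσ)) using 1
  ext x
  simp

theorem continuous_weight (v : V) : Continuous fun p : GeomRealization K => p.weight v :=
  continuous_def.2 fun _ hO => isOpen_iff.2 fun _ _ =>
    hO.preimage ((continuous_apply v).comp continuous_subtype_val)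

/-- A closed simplex of the realization, with the subspace topology, is homeomorphic to a standard
simplex through its barycentric coordinates. -/
noncomputable def closedSimplexHomeomorph (hσ : σ ∈ K.faces) :
    closedSimplex K σ ≃ₜ coordSimplex σ where
  toFun p := ⟨p.1.weight, weight_mem_coordSimplex p.1 p.2⟩
  invFun f := ⟨ofCoords hσ f, ofCoords_mem_closedSimplex hσ f⟩
  left_inv p := Subtype.ext (ofCoords_weight hσ p.1 p.2)
  right_inv _ := rfl
  continuous_toFun := Continuous.subtype_mk
    (continuous_pi fun v => (continuous_weight v).comp continuous_subtype_val) _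
  continuous_invFun := (continuous_ofCoords hσ).subtype_mk _

theorem support_weight_vertex (v : V) : (vertex K v).weight.support = {v} :=
  Finsupp.support_single v one_ne_zero

theorem vertex_mem_closedSimplex (hv : v ∈ σ) : vertex K v ∈ closedSimplex K σ :=
  (support_weight_vertex v).trans_subset (Finset.singleton_subset_iff.2 hv)

theorem isSimplyConnected_closedSimplex (hσ : σ ∈ K.faces) :
    IsSimplyConnected (closedSimplex K σ) := by
  obtain ⟨v, hv⟩ := K.isRelLowerSet_faces.prop_of_mem hσ
  have := (convex_coordSimplex σ).contractibleSpace
    ⟨_, weight_mem_coordSimplex (vertex K v) (vertex_mem_closedSimplex hv)⟩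
  have := (closedSimplexHomeomorph hσ).contractibleSpace
  exact inferInstanceAs (SimplyConnectedSpace (closedSimplex K σ))

/-- The open star of the vertex `v`: the union of the open simplices having `v` as a vertex. -/
def openStar (K : AbstractSimplicialComplex V) (v : V) : Set (GeomRealization K) :=
  {p | v ∈ p.weight.support}

theorem mem_openStar_iff {p : GeomRealization K} : p ∈ openStar K v ↔ 0 < p.weight v :=
  Finsupp.mem_support_iff.trans (p.nonneg v).lt_iff_ne'.symm

theorem isOpen_openStar (v : V) : IsOpen (openStar K v) := by
  have : openStar K v = (fun p : GeomRealization K => p.weight v) ⁻¹' Set.Ioi 0 :=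
    Set.ext fun _ => mem_openStar_iff
  exact this ▸ isOpen_Ioi.preimage (continuous_weight v)

theorem exists_mem_openStar (p : GeomRealization K) : ∃ v, p ∈ openStar K v :=
  K.isRelLowerSet_faces.prop_of_mem p.support_mem

theorem vertex_mem_openStar_iff : vertex K w ∈ openStar K v ↔ v = w := by
  rw [← Finset.mem_singleton, ← support_weight_vertex (K := K)]
  rfl

theorem vertex_mem_openStar (v : V) : vertex K v ∈ openStar K v :=
  vertex_mem_openStar_iff.2 rfl

/-- The point at time `t` on the segment from `p` to a vertex `v` of the carrier of `p`. -/
noncomputable def contractStar (p : openStar K v) (t : unitInterval) : GeomRealization K :=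
  ofCoords p.1.support_mem ⟨AffineMap.lineMap p.1.weight (vertex K v).weight (t : ℝ),
    (convex_coordSimplex _).lineMap_mem
      (weight_mem_coordSimplex p.1 (mem_closedSimplex_support p.1))
      (weight_mem_coordSimplex (vertex K v) (vertex_mem_closedSimplex p.2)) t.2⟩

theorem contractStar_weight (p : openStar K v) (t : unitInterval) (w : V) :
    (contractStar p t).weight w =
      AffineMap.lineMap (p.1.weight w) ((vertex K v).weight w) (t : ℝ) :=
  AffineMap.pi_lineMap_apply (p.1.weight : V → ℝ) (vertex K v).weight (t : ℝ) w

theorem contractStar_zero (p : openStar K v) : contractStar p 0 = p := by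
  ext w
  simp [contractStar_weight]

theorem contractStar_one (p : openStar K v) : contractStar p 1 = vertex K v := by
  ext w
  simp [contractStar_weight]

theorem contractStar_mem_openStar (p : openStar K v) (t : unitInterval) :
    contractStar p t ∈ openStar K v := by
  rw [mem_openStar_iff, contractStar_weight]
  exact (convex_Ioi (0 : ℝ)).lineMap_mem (mem_openStar_iff.1 p.2)
    (mem_openStar_iff.1 (vertex_mem_openStar v)) t.2

theorem contractStar_mem_closedSimplex (p : openStar K v) (t : unitInterval)
    (hp : p.1 ∈ closedSimplex K σ) : contractStar p t ∈ closedSimplex K σ :=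
  Finset.Subset.trans (ofCoords_mem_closedSimplex _ _) hp

theorem continuous_uncurry_contractStar_comp {A : Type w} [TopologicalSpace A] (hσ : σ ∈ K.faces)
    {f : A → openStar K v} (hfσ : ∀ a, (f a).1 ∈ closedSimplex K σ)
    (hf : ∀ w, Continuous fun a => (f a).1.weight w) :
    Continuous fun x : A × unitInterval => contractStar (f x.1) x.2 := by
  refine continuous_of_continuous_weight hσ
    (fun x => contractStar_mem_closedSimplex (f x.1) x.2 (hfσ x.1)) fun w => ?_
  have := (hf w).comp (continuous_fst (X := A) (Y := unitInterval))
  simp only [contractStar_weight, AffineMap.lineMap_apply_ring']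
  fun_prop

theorem continuous_contractStar (p : openStar K v) : Continuous (contractStar p) := by
  have := continuous_uncurry_contractStar_comp p.1.support_mem (f := fun _ : Unit => p)
    (fun _ => mem_closedSimplex_support p.1) fun _ => continuous_const
  exact this.comp (f := fun t => ((), t)) (by fun_prop)

/- Continuity can be checked on simplices for maps from an open subset of the realization, but not
for maps from its product with the interval; currying moves the interval to the codomain. -/
theorem continuous_uncurry_contractStar (v : V) :
    Continuous fun x : openStar K v × unitInterval => contractStar x.1 x.2 := by
  let curried (p : openStar K v) : C(unitInterval, GeomRealization K) :=
    ⟨contractStar p, continuous_contractStar p⟩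
  have hcurried : Continuous curried := by
    refine continuous_of_continuous_comp_ofCoords (isOpen_openStar v) fun σ hσ => ?_
    refine ContinuousMap.continuous_of_continuous_uncurry _ ?_
    exact continuous_uncurry_contractStar_comp hσ
      (f := fun x : {x : coordSimplex σ // ofCoords hσ x ∈ openStar K v} => ⟨ofCoords hσ x, x.2⟩)
      (fun x => ofCoords_mem_closedSimplex hσ x.1)
      fun w => (continuous_apply w).comp (continuous_subtype_val.comp continuous_subtype_val)
  exact ContinuousMap.continuous_uncurry_of_continuous ⟨curried, hcurried⟩

theorem isSimplyConnected_openStar (v : V) : IsSimplyConnected (openStar K v) := by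
  let contraction : C(unitInterval × openStar K v, openStar K v) :=
    ⟨fun x => ⟨contractStar x.2 x.1, contractStar_mem_openStar x.2 x.1⟩,
      ((continuous_uncurry_contractStar v).comp continuous_swap).subtype_mk _⟩
  have : ContractibleSpace (openStar K v) :=
    (contractible_iff_id_nullhomotopic _).2 ⟨⟨vertex K v, vertex_mem_openStar v⟩,
      ⟨⟨contraction, fun p => Subtype.ext (contractStar_zero p),
        fun p => Subtype.ext (contractStar_one p)⟩⟩⟩
  exact inferInstanceAs (SimplyConnectedSpace (openStar K v))

end GeomRealization

/-! ### Edge paths -/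

namespace GeomRealization

variable {V : Type u} {K L : AbstractSimplicialComplex V} {σ τ : Finset V} {u v w : V}

/-- The vertex `v` as an object of the fundamental groupoid of the realization. -/
noncomputable abbrev vertexObj (K : AbstractSimplicialComplex V) (v : V) :
    FundamentalGroupoid (GeomRealization K) :=
  FundamentalGroupoid.mk (vertex K v)

/-- The homotopy class of the edge between two vertices of a face. -/
noncomputable def edgeHom (hσ : σ ∈ K.faces) (hv : v ∈ σ) (hw : w ∈ σ) :
    vertexObj K v ⟶ vertexObj K w :=
  pathClassIn (isSimplyConnected_closedSimplex hσ) (vertex_mem_closedSimplex hv)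
    (vertex_mem_closedSimplex hw)

theorem edgeHom_comp (hσ : σ ∈ K.faces) (hu : u ∈ σ) (hv : v ∈ σ) (hw : w ∈ σ) :
    edgeHom hσ hu hv ≫ edgeHom hσ hv hw = edgeHom hσ hu hw :=
  pathClassIn_comp _ _ _ _

theorem edgeHom_congr (hσ : σ ∈ K.faces) (hτ : τ ∈ K.faces) (hvσ : v ∈ σ) (hwσ : w ∈ σ)
    (hvτ : v ∈ τ) (hwτ : w ∈ τ) : edgeHom hσ hvσ hwσ = edgeHom hτ hvτ hwτ := by
  classical
  have pair_subset {ρ : Finset V} (hv : v ∈ ρ) (hw : w ∈ ρ) : {v, w} ⊆ ρ :=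
    Finset.insert_subset hv (Finset.singleton_subset_iff.2 hw)
  have pair_mem_faces : {v, w} ∈ K.faces :=
    K.isRelLowerSet_faces.mem_of_le hσ (pair_subset hvσ hwσ) (Finset.insert_nonempty _ _)
  have edgeHom_pair {ρ : Finset V} (hρ : ρ ∈ K.faces) (hv : v ∈ ρ) (hw : w ∈ ρ) :
      edgeHom pair_mem_faces (Finset.mem_insert_self v {w}) (by simp) = edgeHom hρ hv hw :=
    pathClassIn_mono _ _ (fun _ hp => subset_trans hp (pair_subset hv hw)) _ _
  rw [← edgeHom_pair hσ, edgeHom_pair hτ]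

/-- The map on path classes between vertices induced by the inclusion of a subcomplex. -/
noncomputable def mapInclusion (h : K.faces ⊆ L.faces) (f : vertexObj K v ⟶ vertexObj K w) :
    vertexObj L v ⟶ vertexObj L w :=
  (FundamentalGroupoid.map (inclusion h)).map f

theorem mapInclusion_comp (h : K.faces ⊆ L.faces) (f : vertexObj K u ⟶ vertexObj K v)
    (g : vertexObj K v ⟶ vertexObj K w) :
    mapInclusion h (f ≫ g) = mapInclusion h f ≫ mapInclusion h g :=
  Functor.map_comp _ _ _

theorem mapInclusion_edgeHom (h : K.faces ⊆ L.faces) (hσ : σ ∈ K.faces) (hv : v ∈ σ)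
    (hw : w ∈ σ) : mapInclusion h (edgeHom hσ hv hw) = edgeHom (h hσ) hv hw :=
  map_pathClassIn _ (isSimplyConnected_closedSimplex (h hσ)) (inclusion h) (fun _ hp => hp) _ _

/-- The class of the radial path from a vertex to a point of its open star. -/
noncomputable def radial {p : GeomRealization K} (hp : p ∈ openStar K v) :
    vertexObj K v ⟶ FundamentalGroupoid.mk p :=
  pathClassIn (isSimplyConnected_openStar v) (vertex_mem_openStar v) hp

theorem radial_vertex (v : V) : radial (vertex_mem_openStar v) = 𝟙 (vertexObj K v) :=
  pathClassIn_self _ _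

theorem radial_eq_pathClassIn_closedSimplex {p : GeomRealization K} (hp : p ∈ openStar K v) :
    radial hp = pathClassIn (isSimplyConnected_closedSimplex p.support_mem)
      (vertex_mem_closedSimplex hp) (mem_closedSimplex_support p) := by
  let segment : Path (vertex K v) p :=
    { toFun := fun t => contractStar ⟨p, hp⟩ (unitInterval.symm t)
      continuous_toFun := (continuous_contractStar _).comp (by fun_prop)
      source' := by rw [unitInterval.symm_zero, contractStar_one]
      target' := by rw [unitInterval.symm_one, contractStar_zero] }
  rw [radial, ← pathClass_eq_pathClassIn _ _ _ segment fun t => contractStar_mem_openStar _ _]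
  exact pathClass_eq_pathClassIn _ _ _ segment fun t =>
    contractStar_mem_closedSimplex _ _ (mem_closedSimplex_support p)

theorem edgeHom_comp_radial {p : GeomRealization K} (hv : p ∈ openStar K v)
    (hw : p ∈ openStar K w) : edgeHom p.support_mem hv hw ≫ radial hw = radial hv := by
  rw [radial_eq_pathClassIn_closedSimplex, radial_eq_pathClassIn_closedSimplex]
  exact pathClassIn_comp _ _ _ _

theorem radial_comp_pathClass {p q : GeomRealization K} (hp : p ∈ openStar K v)
    (hq : q ∈ openStar K v) (γ : Path p q) (h : ∀ t, γ t ∈ openStar K v) :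
    radial hp ≫ pathClass γ = radial hq := by
  rw [pathClass_eq_pathClassIn (isSimplyConnected_openStar v) hp hq γ h, radial, radial,
    pathClassIn_comp]

theorem vertexObj_hom_induction {P : ∀ {v w : V}, (vertexObj K v ⟶ vertexObj K w) → Prop}
    (of_edge : ∀ {σ : Finset V} (hσ : σ ∈ K.faces) {v w : V} (hv : v ∈ σ) (hw : w ∈ σ),
      P (edgeHom hσ hv hw))
    (of_comp : ∀ {u v w : V} {f : vertexObj K u ⟶ vertexObj K v}
      {g : vertexObj K v ⟶ vertexObj K w}, P f → P g → P (f ≫ g))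
    (f : vertexObj K v ⟶ vertexObj K w) : P f := by
  have of_any_path : ∀ v w (hv : vertex K _ ∈ openStar K v) (hw : vertex K _ ∈ openStar K w),
      P (radial hv ≫ f ≫ inv (radial hw)) := by
    refine fundamentalGroupoid_hom_induction isOpen_openStar exists_mem_openStar
      (P := fun {p q} f => ∀ v w (hv : p ∈ openStar K v) (hw : q ∈ openStar K w),
        P (radial hv ≫ f ≫ inv (radial hw))) ?_ ?_ f
    · intro i p q γ hγ v w hv hw
      have hp : p ∈ openStar K i := γ.source ▸ hγ 0
      have hq : q ∈ openStar K i := γ.target ▸ hγ 1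
      rw [← edgeHom_comp_radial hv hp, Category.assoc, ← Category.assoc (radial hp),
        radial_comp_pathClass hp hq γ hγ, ← edgeHom_comp_radial hq hw, Category.assoc,
        IsIso.hom_inv_id, Category.comp_id]
      exact of_comp (of_edge _ _ _) (of_edge _ _ _)
    · intro p q r f g hf hg v w hv hw
      obtain ⟨i, hi⟩ := exists_mem_openStar q
      have := of_comp (hf v i hv hi) (hg i w hi hw)
      simpa only [Category.assoc, IsIso.inv_hom_id_assoc] using this
  have := of_any_path v w (vertex_mem_openStar v) (vertex_mem_openStar w)
  rwa [radial_vertex, radial_vertex, IsIso.inv_id, Category.comp_id, Category.id_comp] at this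

end GeomRealization

/-! ### Cocycles and their monodromy -/

namespace GeomRealization

variable {V : Type u} {K L : AbstractSimplicialComplex V} {σ : Finset V} {v w : V}
  {G : Type v} [Group G]

/-- A group-valued 1-cocycle on a simplicial complex. The product `φ v w * φ u v` is written in the
order of composition of functions; values on pairs not contained in a face are irrelevant. -/
def IsCocycle (L : AbstractSimplicialComplex V) (φ : V → V → G) : Prop :=
  ∀ σ ∈ L.faces, ∀ u ∈ σ, ∀ v ∈ σ, ∀ w ∈ σ, φ v w * φ u v = φ u w

theorem IsCocycle.self {φ : V → V → G} (hφ : IsCocycle L φ) (v : V) : φ v v = 1 := by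
  have hv := Finset.mem_singleton_self v
  exact mul_eq_left.1 (hφ {v} (L.singleton_mem v) v hv v hv v hv)

/-- A chosen vertex of the carrier of a point. -/
noncomputable def someVertex (p : GeomRealization L) : V :=
  (exists_mem_openStar p).choose

theorem mem_openStar_someVertex (p : GeomRealization L) : p ∈ openStar L (someVertex p) :=
  (exists_mem_openStar p).choose_spec

theorem someVertex_vertex (v : V) : someVertex (vertex L v) = v :=
  vertex_mem_openStar_iff.1 (mem_openStar_someVertex (vertex L v))

variable [TopologicalSpace G] [DiscreteTopology G] {φ : V → V → G}

/-- The principal bundle with discrete fibre `G` determined by a cocycle: it is trivial over the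
open stars of the vertices, and the cocycle gives the changes of coordinates. -/
noncomputable def cocycleBundle (hφ : IsCocycle L φ) :
    FiberBundleCore V (GeomRealization L) G where
  baseSet := openStar L
  isOpen_baseSet := isOpen_openStar
  indexAt := someVertex
  mem_baseSet_at := mem_openStar_someVertex
  coordChange v w _ g := φ v w * g
  coordChange_self v p _ g := by rw [hφ.self, one_mul]
  continuousOn_coordChange v w := by fun_prop
  coordChange_comp u v w p hp g := by
    rw [← mul_assoc, hφ _ p.support_mem u hp.1.1 v hp.1.2 w hp.2]

theorem isCoveringMap_cocycleBundle_proj (hφ : IsCocycle L φ) :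
    IsCoveringMap (cocycleBundle hφ).proj :=
  FiberBundle.isCoveringMap (F := G) (E := (cocycleBundle hφ).Fiber)

/-- The point of the covering defined by a cocycle that lies over the vertex `v` and has coordinate
`g` in the trivialization over the open star of `v`. -/
noncomputable def overVertex (hφ : IsCocycle L φ) (v : V) (g : G) :
    (cocycleBundle hφ).proj ⁻¹' {vertex L v} :=
  ⟨⟨vertex L v, g⟩, rfl⟩

theorem overVertex_injective (hφ : IsCocycle L φ) (v : V) :
    Function.Injective (overVertex hφ v) :=
  fun _ _ h => congrArg (fun e => (e.1.2 : G)) h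

theorem continuous_cocycleBundle_section (hφ : IsCocycle L φ) (hσ : σ ∈ L.faces) (hv : v ∈ σ)
    (g : G) : Continuous fun p : closedSimplex L σ =>
      (⟨p.1, φ v (someVertex p.1) * g⟩ : (cocycleBundle hφ).TotalSpace) := by
  refine continuous_iff_continuousAt.2 fun p => (FiberBundle.continuousAt_totalSpace G _).2
    ⟨continuous_subtype_val.continuousAt, ?_⟩
  have someVertex_mem (q : closedSimplex L σ) : someVertex q.1 ∈ σ :=
    q.2 (mem_openStar_someVertex q.1)
  refine (continuousAt_const (y := φ v (someVertex p.1) * g)).congr (.of_forall fun q => ?_)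
  change _ = φ (someVertex q.1) (someVertex p.1) * (φ v (someVertex q.1) * g)
  rw [← mul_assoc, hφ σ hσ v hv _ (someVertex_mem q) _ (someVertex_mem p)]

theorem monodromy_edgeHom_overVertex (hφ : IsCocycle L φ) (hσ : σ ∈ L.faces) (hv : v ∈ σ)
    (hw : w ∈ σ) (g : G) :
    (isCoveringMap_cocycleBundle_proj hφ).monodromy (edgeHom hσ hv hw) (overVertex hφ v g) =
      overVertex hφ w (φ v w * g) := by
  have := monodromy_pathClassIn (isCoveringMap_cocycleBundle_proj hφ)
    (isSimplyConnected_closedSimplex hσ) (continuous_cocycleBundle_section hφ hσ hv g)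
    (fun _ => rfl) (vertex_mem_closedSimplex hv) (vertex_mem_closedSimplex hw)
  simp only [someVertex_vertex, hφ.self, one_mul] at this
  exact this

theorem monodromy_mapInclusion_overVertex (h : K.faces ⊆ L.faces) (hφ : IsCocycle L φ)
    {ψ : ∀ {v w : V}, (vertexObj K v ⟶ vertexObj K w) → G}
    (ψ_edge : ∀ {σ : Finset V} (hσ : σ ∈ K.faces) {v w : V} (hv : v ∈ σ) (hw : w ∈ σ),
      ψ (edgeHom hσ hv hw) = φ v w)
    (ψ_comp : ∀ {u v w : V} (f : vertexObj K u ⟶ vertexObj K v)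
      (f' : vertexObj K v ⟶ vertexObj K w), ψ (f ≫ f') = ψ f' * ψ f)
    (f : vertexObj K v ⟶ vertexObj K w) (g : G) :
    (isCoveringMap_cocycleBundle_proj hφ).monodromy (mapInclusion h f) (overVertex hφ v g) =
      overVertex hφ w (ψ f * g) := by
  revert g
  refine vertexObj_hom_induction (P := fun {v w} f => ∀ g,
    (isCoveringMap_cocycleBundle_proj hφ).monodromy (mapInclusion h f) (overVertex hφ v g) =
      overVertex hφ w (ψ f * g)) ?_ ?_ f
  · intro σ hσ v w hv hw g
    rw [mapInclusion_edgeHom, monodromy_edgeHom_overVertex, ψ_edge]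
  · intro u v w f f' hf hf' g
    rw [mapInclusion_comp, ψ_comp, mul_assoc, ← hf', ← hf]
    exact (isCoveringMap_cocycleBundle_proj hφ).monodromy_trans_apply _ _ _

end GeomRealization

section BasedLoop

variable {𝒢 : Type u} [Groupoid.{v} 𝒢] {x₀ x y z : 𝒢}

/-- The loop at `x₀` that runs to the source of `f` along `a`, follows `f` and returns along `b`. -/
def basedLoop (a : x₀ ⟶ x) (b : x₀ ⟶ y) (f : x ⟶ y) : End x₀ :=
  a ≫ f ≫ Groupoid.inv b

theorem basedLoop_comp (a : x₀ ⟶ x) (b : x₀ ⟶ y) (c : x₀ ⟶ z) (f : x ⟶ y) (g : y ⟶ z) :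
    basedLoop a c (f ≫ g) = basedLoop b c g * basedLoop a b f := by
  simp [basedLoop, End.mul_def]

theorem basedLoop_injective (a : x₀ ⟶ x) (b : x₀ ⟶ y) :
    Function.Injective (basedLoop a b : (x ⟶ y) → End x₀) :=
  fun _ _ h => (cancel_mono (Groupoid.inv b)).1 ((cancel_epi a).1 h)

end BasedLoop

namespace GeomRealization

variable {V : Type u} {K L : AbstractSimplicialComplex V} {v₀ : V}

/-- The tautological cocycle with values in the fundamental group at `v₀`: an edge is closed up to
a loop by means of chosen path classes `c` from `v₀` to its endpoints. -/
noncomputable def edgeCocycle (c : ∀ v, vertexObj K v₀ ⟶ vertexObj K v) (v w : V) :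
    FundamentalGroup (GeomRealization K) (vertex K v₀) :=
  open Classical in
  if h : ∃ σ ∈ K.faces, v ∈ σ ∧ w ∈ σ then
    basedLoop (c v) (c w)
      (edgeHom h.choose_spec.1 h.choose_spec.2.1 h.choose_spec.2.2)
  else 1

theorem edgeCocycle_eq (c : ∀ v, vertexObj K v₀ ⟶ vertexObj K v) {σ : Finset V} {v w : V}
    (hσ : σ ∈ K.faces) (hv : v ∈ σ) (hw : w ∈ σ) :
    edgeCocycle c v w = basedLoop (c v) (c w) (edgeHom hσ hv hw) := by
  rw [edgeCocycle, dif_pos ⟨σ, hσ, hv, hw⟩]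
  exact congrArg _ (edgeHom_congr _ _ _ _ _ _)

theorem isCocycle_edgeCocycle (c : ∀ v, vertexObj K v₀ ⟶ vertexObj K v) :
    IsCocycle K (edgeCocycle c) := by
  intro σ hσ u hu v hv w hw
  rw [edgeCocycle_eq c hσ hv hw, edgeCocycle_eq c hσ hu hv, edgeCocycle_eq c hσ hu hw,
    ← edgeHom_comp hσ hu hv hw]
  exact (basedLoop_comp _ _ _ _ _).symm

theorem injective_map_inclusion_of_cocycles_extend (h : K.faces ⊆ L.faces)
    (hconn : ∀ v, Nonempty (vertexObj K v₀ ⟶ vertexObj K v))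
    (hext : ∀ g : V → V → FundamentalGroup (GeomRealization K) (vertex K v₀), IsCocycle K g →
      ∃ φ, IsCocycle L φ ∧ ∀ σ ∈ K.faces, ∀ v ∈ σ, ∀ w ∈ σ, φ v w = g v w) :
    Function.Injective (FundamentalGroup.map (inclusion h) (vertex K v₀)) := by
  have c v : vertexObj K v₀ ⟶ vertexObj K v := (hconn v).some
  obtain ⟨φ, hφ, hφc⟩ := hext (edgeCocycle c) (isCocycle_edgeCocycle c)
  let _ : TopologicalSpace (FundamentalGroup (GeomRealization K) (vertex K v₀)) := ⊥
  have : DiscreteTopology (FundamentalGroup (GeomRealization K) (vertex K v₀)) := ⟨rfl⟩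
  have monodromy_eq (f : vertexObj K v₀ ⟶ vertexObj K v₀) :=
    monodromy_mapInclusion_overVertex h hφ (ψ := fun {v w} f => basedLoop (c v) (c w) f)
      (fun hσ _ _ hv hw => by rw [hφc _ hσ _ hv _ hw, edgeCocycle_eq])
      (fun f f' => basedLoop_comp _ _ _ f f') f 1
  intro f f' hff'
  have overVertex_eq := (monodromy_eq f).symm.trans
    ((congrArg (fun e => (isCoveringMap_cocycleBundle_proj hφ).monodromy e _) hff').trans
      (monodromy_eq f'))
  exact basedLoop_injective _ _ (mul_left_injective 1 (overVertex_injective hφ v₀ overVertex_eq))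

end GeomRealization

/-! ### Length spaces and totally bounded spaces -/

section Metric

open Filter Topology

/-- The metric form of being a length space: two points at distance less than `s + t` have a point
between them at distance less than `s` from the first and less than `t` from the second. It is
the form in which geodesics are used to subdivide edges of Rips complexes. -/
def HasIntermediatePoints (X : Type u) [PseudoMetricSpace X] : Prop :=
  ∀ ⦃x y : X⦄ ⦃s t : ℝ⦄, 0 < s → 0 < t → dist x y < s + t → ∃ z, dist x z < s ∧ dist z y < t

theorem IsGeodesicSpace.hasIntermediatePoints {X : Type u} [MetricSpace X]
    (hX : IsGeodesicSpace X) : HasIntermediatePoints X := by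
  intro x y s t hs ht hxy
  obtain ⟨γ, hγ₀, hγ₁, hγ⟩ := hX x y
  have hst : 0 < s + t := add_pos hs ht
  set d := dist x y
  have hd : 0 ≤ d := dist_nonneg
  have left_lt : d * s / (s + t) < s := by
    rw [div_lt_iff₀ hst, mul_comm]
    gcongr
  have right_lt : d * t / (s + t) < t := by
    rw [div_lt_iff₀ hst, mul_comm]
    gcongr
  have left_nonneg : 0 ≤ d * s / (s + t) := by positivity
  have right_nonneg : 0 ≤ d * t / (s + t) := by positivity
  have add_eq : d * s / (s + t) + d * t / (s + t) = d := by field_simp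
  have mem_Icc : d * s / (s + t) ∈ Set.Icc 0 d := ⟨left_nonneg, by linarith⟩
  refine ⟨γ (d * s / (s + t)), ?_, ?_⟩
  · rw [← hγ₀, hγ _ ⟨le_rfl, hd⟩ _ mem_Icc, zero_sub, abs_neg, abs_of_nonneg left_nonneg]
    exact left_lt
  · rw [← hγ₁, hγ _ mem_Icc _ ⟨hd, le_rfl⟩, abs_sub_comm, abs_of_nonneg (by linarith)]
    linarith

theorem totallyBounded_prod {Y Z : Type*} [UniformSpace Y] [UniformSpace Z] {s : Set Y}
    {t : Set Z} (hs : TotallyBounded s) (ht : TotallyBounded t) : TotallyBounded (s ×ˢ t) := by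
  rw [totallyBounded_iff_ultrafilter] at hs ht ⊢
  intro f hf
  rw [le_principal_iff] at hf
  refine cauchy_prod_iff.2 ⟨hs (f.map Prod.fst) ?_, ht (f.map Prod.snd) ?_⟩
  · exact tendsto_principal.2 (mem_of_superset hf fun _ h => h.1)
  · exact tendsto_principal.2 (mem_of_superset hf fun _ h => h.2)

theorem eventually_forall_exists_dist_lt_of_totallyBounded {Y : Type*} [PseudoMetricSpace Y]
    {s : Set Y} (hs : TotallyBounded s) (F : Y → ℝ) {δ : ℝ} (hδ : 0 < δ) (p : ℝ) :
    ∀ᶠ q in 𝓝 p, ∀ y ∈ s, F y < p → ∃ y', dist y y' < δ ∧ F y' < q := by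
  obtain ⟨t, -, ht, hst⟩ := Metric.finite_approx_of_totallyBounded hs (δ / 2) (half_pos hδ)
  have near_net : ∀ᶠ q in 𝓝 p, ∀ a ∈ t, (∃ y, dist y a < δ / 2 ∧ F y < p) →
      ∃ y, dist y a < δ / 2 ∧ F y < q := by
    refine (eventually_all_finite ht).2 fun a _ => ?_
    by_cases h : ∃ y, dist y a < δ / 2 ∧ F y < p
    · obtain ⟨y, hya, hy⟩ := h
      filter_upwards [eventually_gt_nhds hy] with q hq _ using ⟨y, hya, hq⟩
    · exact .of_forall fun q h' => absurd h' h
  filter_upwards [near_net] with q hq y hy hFy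
  obtain ⟨a, ha, hya⟩ := Set.mem_iUnion₂.1 (hst hy)
  obtain ⟨y', hy'a, hFy'⟩ := hq a ha ⟨y, hya, hFy⟩
  refine ⟨y', ?_, hFy'⟩
  calc dist y y' ≤ dist y a + dist y' a := dist_triangle_right _ _ _
    _ < δ / 2 + δ / 2 := add_lt_add hya hy'a
    _ = δ := add_halves δ

/-- Every triple of points with pairwise distances less than `p` lies within `δ`, pointwise, of a
triple with pairwise distances less than `q`; cocycle identities at scale `q` are transported along
such approximations. -/
def TriplesApproximable (X : Type u) [PseudoMetricSpace X] (δ p q : ℝ) : Prop :=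
  ∀ ⦃x y z : X⦄, dist x y < p → dist y z < p → dist x z < p →
    ∃ x' y' z' : X, (dist x x' < δ ∧ dist y y' < δ ∧ dist z z' < δ) ∧
      dist x' y' < q ∧ dist y' z' < q ∧ dist x' z' < q

theorem eventually_triplesApproximable {X : Type u} [PseudoMetricSpace X]
    (hb : TotallyBounded (Set.univ : Set X)) {δ : ℝ} (hδ : 0 < δ) (p : ℝ) :
    ∀ᶠ q in 𝓝 p, TriplesApproximable X δ p q := by
  have := eventually_forall_exists_dist_lt_of_totallyBounded
    (totallyBounded_prod hb (totallyBounded_prod hb hb))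
    (fun τ => max (dist τ.1 τ.2.1) (max (dist τ.2.1 τ.2.2) (dist τ.1 τ.2.2))) hδ p
  filter_upwards [this] with q hq x y z hxy hyz hxz
  obtain ⟨⟨x', y', z'⟩, hnear, hsmall⟩ :=
    hq (x, y, z) ⟨trivial, trivial, trivial⟩ (max_lt hxy (max_lt hyz hxz))
  simp only [Prod.dist_eq, max_lt_iff] at hnear hsmall
  exact ⟨x', y', z', hnear, hsmall⟩

end Metric

/-! ### Cocycles on Rips complexes -/

section Rips

open GeomRealization

variable {X : Type u} [MetricSpace X] {p q r : Set.Ioi (0 : ℝ)}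

theorem mem_openRips_iff {σ : Finset X} :
    σ ∈ (openRips X r).faces ↔ σ.Nonempty ∧ ∀ x ∈ σ, ∀ y ∈ σ, dist x y < r := by
  refine ⟨fun hσ => ⟨hσ.1, fun x hx y hy =>
    (Metric.dist_le_diam_of_mem σ.finite_toSet.isBounded hx hy).trans_lt hσ.2⟩,
    fun ⟨hne, hσ⟩ => ⟨hne, ?_⟩⟩
  obtain ⟨⟨x, y⟩, hxy, hmax⟩ :=
    (σ ×ˢ σ).exists_max_image (fun e => dist e.1 e.2) (hne.product hne)
  obtain ⟨hx, hy⟩ := Finset.mem_product.1 hxy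
  refine (Metric.diam_le_of_forall_dist_le dist_nonneg fun v hv w hw => ?_).trans_lt (hσ x hx y hy)
  exact hmax (v, w) (Finset.mem_product.2 ⟨hv, hw⟩)

theorem exists_triple_mem_openRips {x y z : X} (hxy : dist x y < r) (hyz : dist y z < r)
    (hxz : dist x z < r) : ∃ σ ∈ (openRips X r).faces, x ∈ σ ∧ y ∈ σ ∧ z ∈ σ := by
  classical
  have hr : (0 : ℝ) < r := r.2
  refine ⟨{x, y, z}, mem_openRips_iff.2 ⟨Finset.insert_nonempty _ _, ?_⟩, by simp⟩
  simp [hxy, hyz, hxz, dist_comm y x, dist_comm z x, dist_comm z y, hr]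

theorem exists_pair_mem_openRips {x y : X} (h : dist x y < r) :
    ∃ σ ∈ (openRips X r).faces, x ∈ σ ∧ y ∈ σ := by
  obtain ⟨σ, hσ, hx, hy, -⟩ := exists_triple_mem_openRips h ((dist_self y).trans_lt r.2) h
  exact ⟨σ, hσ, hx, hy⟩

variable {G : Type v} [Group G] {g : X → X → G}

theorem isCocycle_openRips_iff : IsCocycle (openRips X r) g ↔
    ∀ ⦃x y z : X⦄, dist x y < r → dist y z < r → dist x z < r → g y z * g x y = g x z := by
  refine ⟨fun hg x y z hxy hyz hxz => ?_, fun hg σ hσ x hx y hy z hz => ?_⟩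
  · obtain ⟨σ, hσ, hx, hy, hz⟩ := exists_triple_mem_openRips hxy hyz hxz
    exact hg σ hσ x hx y hy z hz
  · have hdist := (mem_openRips_iff.1 hσ).2
    exact hg (hdist x hx y hy) (hdist y hy z hz) (hdist x hx z hz)

/-- The diagonals `x b'`, `b b'` and `b y'` cut the hexagon `x b y y' b' x'` into four triangles of
diameter less than `q`. -/
theorem GeomRealization.IsCocycle.openRips_hexagon (hg : IsCocycle (openRips X q) g)
    (hpq : 3 * (p : ℝ) / 4 ≤ q) {x b y x' b' y' : X} (hxb : dist x b < 2 * p / 3)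
    (hby : dist b y < p / 3) (hxb' : dist x' b' < 2 * p / 3) (hby' : dist b' y' < p / 3)
    (hx : dist x x' < p / 12) (hy : dist y y' < p / 12) :
    g y y' * (g b y * g x b) = g b' y' * g x' b' * g x x' := by
  have hp : (0 : ℝ) < p := p.2
  have hby'_lt : dist b y' < 5 * p / 12 := by linarith [dist_triangle b y y']
  have hxb'_lt : dist x b' < 3 * p / 4 := by linarith [dist_triangle x x' b']
  have hbb' : dist b b' < 3 * p / 4 := by linarith [dist_triangle_right b b' y']
  rw [isCocycle_openRips_iff] at hg
  calc g y y' * (g b y * g x b) = g b y' * g x b := by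
        rw [← mul_assoc, hg (y := y) (by linarith) (by linarith) (by linarith)]
    _ = g b' y' * (g b b' * g x b) := by
        rw [← mul_assoc, hg (y := b') (by linarith) (by linarith) (by linarith)]
    _ = g b' y' * g x b' := by rw [hg (by linarith) (by linarith) (by linarith)]
    _ = g b' y' * g x' b' * g x x' := by
        rw [mul_assoc, hg (y := x') (by linarith) (by linarith) (by linarith)]

theorem exists_isCocycle_openRips_extending (hX : HasIntermediatePoints X) (hqp : q ≤ p)
    (hpq : 3 * (p : ℝ) / 4 ≤ q) (happrox : TriplesApproximable X (p / 12) p q)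
    (hg : IsCocycle (openRips X q) g) :
    ∃ φ, IsCocycle (openRips X p) φ ∧ ∀ x y, dist x y < q → φ x y = g x y := by
  have hp : (0 : ℝ) < p := p.2
  have hqp' : (q : ℝ) ≤ p := hqp
  choose! b hxb hby using fun (x y : X) (hxy : dist x y < p) =>
    hX (s := 2 * p / 3) (t := p / 3) (by positivity) (by positivity) (hxy.trans_eq (by ring))
  have hg_triple := isCocycle_openRips_iff.1 hg
  have extends_g (x y) (hxy : dist x y < q) : g (b x y) y * g x (b x y) = g x y := by
    have hxy' := hxy.trans_le hqp'
    exact hg_triple (by linarith [hxb x y hxy']) (by linarith [hby x y hxy']) hxy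
  have transport {x y x' y'} (hxy : dist x y < p) (hx : dist x x' < p / 12)
      (hy : dist y y' < p / 12) (hxy' : dist x' y' < q) :
      g y y' * (g (b x y) y * g x (b x y)) = g x' y' * g x x' := by
    have hxy'' := hxy'.trans_le hqp'
    rw [← extends_g x' y' hxy']
    exact hg.openRips_hexagon hpq (hxb x y hxy) (hby x y hxy) (hxb x' y' hxy'')
      (hby x' y' hxy'') hx hy
  refine ⟨fun x y => g (b x y) y * g x (b x y), isCocycle_openRips_iff.2 ?_, extends_g⟩
  intro x y z hxy hyz hxz
  obtain ⟨x', y', z', ⟨hx, hy, hz⟩, hxy', hyz', hxz'⟩ := happrox hxy hyz hxz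
  refine mul_left_cancel (a := g z z') ?_
  rw [← mul_assoc, transport hyz hy hz hyz', mul_assoc, transport hxy hx hy hxy', ← mul_assoc,
    hg_triple hxy' hyz' hxz', transport hxz hx hz hxz']

/-! ### Bonding maps of the Rips filtration -/

theorem exists_mapInclusion_eq_edgeHom (hX : HasIntermediatePoints X) (h : q ≤ p) (n : ℕ)
    {σ : Finset X} (hσ : σ ∈ (openRips X p).faces) {x y : X} (hx : x ∈ σ) (hy : y ∈ σ)
    (hxy : dist x y < 2 ^ n * q) :
    ∃ f, mapInclusion (openRips_mono X h) f = edgeHom hσ hx hy := by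
  have hp : (0 : ℝ) < p := p.2
  have hq : (0 : ℝ) < q := q.2
  induction n generalizing σ x y with
  | zero =>
    rw [pow_zero, one_mul] at hxy
    obtain ⟨τ, hτ, hxτ, hyτ⟩ := exists_pair_mem_openRips hxy
    exact ⟨edgeHom hτ hxτ hyτ, (mapInclusion_edgeHom _ _ _ _).trans (edgeHom_congr _ _ _ _ _ _)⟩
  | succ n ih =>
    have hxy_p : dist x y < p := (mem_openRips_iff.1 hσ).2 x hx y hy
    have hs : 0 < min (p : ℝ) (2 ^ n * q) := lt_min hp (by positivity)
    have hxy_s : dist x y < min (p : ℝ) (2 ^ n * q) + min (p : ℝ) (2 ^ n * q) := by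
      rw [← two_mul, mul_min_of_nonneg _ _ zero_le_two]
      exact lt_min (by linarith) (by rwa [← mul_assoc, ← pow_succ'])
    obtain ⟨b, hxb, hby⟩ := hX hs hs hxy_s
    rw [lt_min_iff] at hxb hby
    obtain ⟨τ, hτ, hxτ, hbτ, hyτ⟩ := exists_triple_mem_openRips hxb.1 hby.1 hxy_p
    obtain ⟨f₁, hf₁⟩ := ih hτ hxτ hbτ hxb.2
    obtain ⟨f₂, hf₂⟩ := ih hτ hbτ hyτ hby.2
    refine ⟨f₁ ≫ f₂, ?_⟩
    rw [mapInclusion_comp, hf₁, hf₂, edgeHom_comp]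
    exact edgeHom_congr _ _ _ _ _ _

theorem surjective_mapInclusion_openRips (hX : HasIntermediatePoints X) (h : q ≤ p) (x y : X) :
    Function.Surjective (mapInclusion (openRips_mono X h) (v := x) (w := y)) := by
  intro f
  refine vertexObj_hom_induction
    (P := fun f => ∃ f', mapInclusion (openRips_mono X h) f' = f) ?_ ?_ f
  · intro σ hσ x y hx hy
    have hq : (0 : ℝ) < q := q.2
    obtain ⟨n, hn⟩ := pow_unbounded_of_one_lt (dist x y / q) one_lt_two
    exact exists_mapInclusion_eq_edgeHom hX h n hσ hx hy ((div_lt_iff₀ hq).1 hn)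
  · rintro u v w _ _ ⟨f, rfl⟩ ⟨g, rfl⟩
    exact ⟨f ≫ g, mapInclusion_comp _ _ _⟩

theorem nonempty_vertexObj_openRips_hom (hX : HasIntermediatePoints X) (r : Set.Ioi (0 : ℝ))
    (x y : X) : Nonempty (vertexObj (openRips X r) x ⟶ vertexObj (openRips X r) y) := by
  let R : Set.Ioi (0 : ℝ) := ⟨max r (dist x y + 1), Set.mem_Ioi.2 (lt_max_of_lt_left r.2)⟩
  have hxy : dist x y < R := lt_max_of_lt_right (lt_add_one _)
  obtain ⟨σ, hσ, hx, hy⟩ := exists_pair_mem_openRips hxy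
  have hrR : r ≤ R := Subtype.coe_le_coe.1 (le_max_left _ _)
  obtain ⟨f, -⟩ := surjective_mapInclusion_openRips hX hrR x y (edgeHom hσ hx hy)
  exact ⟨f⟩

theorem isIso_openRipsPiOne_map (hX : HasIntermediatePoints X) (x₀ : X) (hqp : q ≤ p)
    (hpq : 3 * (p : ℝ) / 4 ≤ q) (happrox : TriplesApproximable X (p / 12) p q) :
    IsIso ((openRipsPiOne X x₀).map (homOfLE hqp)) := by
  rw [ConcreteCategory.isIso_iff_bijective]
  constructor
  · change Function.Injective (FundamentalGroup.map (inclusion (openRips_mono X hqp))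
      (vertex (openRips X q) x₀))
    refine injective_map_inclusion_of_cocycles_extend _
      (nonempty_vertexObj_openRips_hom hX q x₀) fun g hg => ?_
    obtain ⟨φ, hφ, hφg⟩ := exists_isCocycle_openRips_extending hX hqp hpq happrox hg
    exact ⟨φ, hφ, fun σ hσ x hx y hy => hφg x y ((mem_openRips_iff.1 hσ).2 x hx y hy)⟩
  · exact surjective_mapInclusion_openRips hX hqp x₀ x₀

open Filter Topology in
theorem exists_forall_isIso_openRipsPiOne_map (hX : HasIntermediatePoints X)
    (hb : TotallyBounded (Set.univ : Set X)) (x₀ : X) (p : Set.Ioi (0 : ℝ)) :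
    ∃ ε₀ : ℝ, 0 < ε₀ ∧ ∀ (q : Set.Ioi (0 : ℝ)) (h : q < p), (p : ℝ) - ε₀ < q →
      IsIso ((openRipsPiOne X x₀).map (homOfLE h.le)) := by
  have hp : (0 : ℝ) < p := p.2
  have h34 : ∀ᶠ q in 𝓝 (p : ℝ), 3 * (p : ℝ) / 4 ≤ q :=
    eventually_ge_nhds (by linarith)
  obtain ⟨ε₀, hε₀, hε⟩ := Metric.eventually_nhds_iff.1
    (h34.and (eventually_triplesApproximable hb (by positivity : 0 < (p : ℝ) / 12) p))
  refine ⟨ε₀, hε₀, fun q hqp hq => ?_⟩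
  have hqp' : (q : ℝ) < p := hqp
  obtain ⟨hpq, happrox⟩ := hε (y := q) (by
    rw [Real.dist_eq, abs_sub_lt_iff]; constructor <;> linarith)
  exact isIso_openRipsPiOne_map hX x₀ hqp.le hpq happrox

end Rips

theorem not_isLeftCriticalValue_of_exists_forall_isIso {𝒞 : Type v} [Category.{w} 𝒞]
    {C : Set.Ioi (0 : ℝ) ⥤ 𝒞} {p : Set.Ioi (0 : ℝ)}
    (h : ∃ ε₀ : ℝ, 0 < ε₀ ∧ ∀ (q : Set.Ioi (0 : ℝ)) (h : q < p), (p : ℝ) - ε₀ < q →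
      IsIso (C.map (homOfLE h.le))) :
    ¬ IsLeftCriticalValue C p := by
  rintro ⟨ε₁, hε₁, not_isIso⟩
  obtain ⟨ε₂, hε₂, isIso⟩ := h
  have hp : (0 : ℝ) < p := p.2
  obtain ⟨q, hq, hqp⟩ := exists_between
    (max_lt hp (max_lt (sub_lt_self (p : ℝ) hε₁) (sub_lt_self (p : ℝ) hε₂)))
  simp only [max_lt_iff] at hq
  exact not_isIso ⟨q, hq.1⟩ hqp hq.2.1 (isIso ⟨q, hq.1⟩ hqp hq.2.2)

theorem mainTheorem12_general (X : Type u) [MetricSpace X] (hX : HasIntermediatePoints X)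
    (hb : TotallyBounded (Set.univ : Set X)) (x₀ : X) :
    (∀ p : Set.Ioi (0 : ℝ), IsCriticalValue (openRipsPiOne X x₀) p →
      IsRightCriticalValue (openRipsPiOne X x₀) p) ∧
    (∀ p : Set.Ioi (0 : ℝ), ¬ IsLeftCriticalValue (openRipsPiOne X x₀) p) ∧
    (∀ p : Set.Ioi (0 : ℝ), ∃ ε₀ : ℝ, 0 < ε₀ ∧
      ∀ (q : Set.Ioi (0 : ℝ)) (h : q < p), (p : ℝ) - ε₀ < q →
        IsIso ((openRipsPiOne X x₀).map (homOfLE h.le))) := by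
  have isIso_below := exists_forall_isIso_openRipsPiOne_map hX hb x₀
  have not_left p : ¬ IsLeftCriticalValue (openRipsPiOne X x₀) p :=
    not_isLeftCriticalValue_of_exists_forall_isIso (isIso_below p)
  exact ⟨fun p hp => hp.resolve_left (not_left p), not_left, isIso_below⟩

theorem mainTheorem12 (X : Type u) [MetricSpace X] [CompactSpace X] (hX : IsGeodesicSpace X)
    (x₀ : X) :
    (∀ p : Set.Ioi (0 : ℝ), IsCriticalValue (openRipsPiOne X x₀) p →
      IsRightCriticalValue (openRipsPiOne X x₀) p) ∧
    (∀ p : Set.Ioi (0 : ℝ), ¬ IsLeftCriticalValue (openRipsPiOne X x₀) p) ∧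
    (∀ p : Set.Ioi (0 : ℝ), ∃ ε₀ : ℝ, 0 < ε₀ ∧
      ∀ (q : Set.Ioi (0 : ℝ)) (h : q < p), (p : ℝ) - ε₀ < q →
        IsIso ((openRipsPiOne X x₀).map (homOfLE h.le))) :=
  mainTheorem12_general X hX.hasIntermediatePoints isCompact_univ.totallyBounded x₀
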